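/- Let $X$ be a nonempty, convex and compact set in a Hausdorff locally convex space $E$, and let $A:X\to 2^X$ and $P:X\times X\to 2^X$ be correspondences (set-valued maps whose values may be empty). Write $\mathrm{Gr}\,A=\{(x,y)\in X\times X: y\in A(x)\}$ and let $\overline{A}:X\to 2^X$ be given by $\overline{A}(x)=\{y\in X:(x,y)\in \mathrm{cl}_{X\times X}\,\mathrm{Gr}\,A\}$. Topological notions refer to the topologies induced on $X$ and $X\times X$. Assume: a) $A$ has nonempty convex values and open lower sections, i.e. $\{x\in X: y\in A(x)\}$ is open in $X$ for each $y\in X$; b) the set $U=\{(x,y)\in X\times X:\overline{A}(x)\cap P(x,y)=\emptyset\}$ is closed and $U\cap \mathrm{Gr}\,\overline{A}$ is nonempty; c) there is a sequence $(P_k)_{k\ge 1}$ of correspondences $P_k:X\times X\to 2^X$ such that, with $U_k=\{(x,y)\in X\times X:\overline{A}(x)\cap P_k(x,y)=\emptyset\}$, c1) for each $k\geq 1$ and each $x\in X$, the set $U_k^+(x)=\{y\in X:\overline{A}(x)\cap P_k(x,y)=\emptyset\}$ is convex and $U_k^+(x)\cap A(x)\neq\emptyset$; c2) for each $k\geq 1$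 and each $y\in X$, the set $U_k^-(y)=\{x\in X:\overline{A}(x)\cap P_k(x,y)=\emptyset\}$ is open in $X$; c3) for each $k\ge 1$, $P_k(x,y)\subseteq P_{k+1}(x,y)$ for each $(x,y)\in X\times X$; c4) for every open set $G\subseteq X\times X$ with $G\supseteq U\cap \mathrm{Gr}\,\overline{A}$, there exists $k\ge 1$ such that $G\supseteq U_k\cap \mathrm{Gr}\,A$. Then there exists $x^*\in X$ such that $x^*\in\overline{A}(x^*)$ and $A(x^*)\cap P(x^*,x^*)=\emptyset$. -/

import Mathlib

/-- The graph of a correspondence `T : α → 2^β`. -/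
def corrGraph {α β : Type*} (T : α → Set β) : Set (α × β) :=
  {p | p.2 ∈ T p.1}

/-- The correspondence `T̄`, whose graph is the closure of the graph of `T`. -/
def corrAdherence {α β : Type*} [TopologicalSpace α] [TopologicalSpace β]
    (T : α → Set β) (x : α) : Set β :=
  {y | (x, y) ∈ closure (corrGraph T)}

/-- The set of pairs `(x, y)` with `T(x) ∩ Q(x, y) = ∅`. -/
def disjointPairs {α β γ : Type*} (T : α → Set γ) (Q : α × β → Set γ) : Set (α × β) :=
  {p | T p.1 ∩ Q p = ∅}

/-- A subset of (the subtype of) `X ⊆ E` is convex if it is convex as a subset of `E`. -/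
def ConvexIn {E : Type*} [AddCommGroup E] [Module ℝ E] {X : Set E} (S : Set X) : Prop :=
  Convex ℝ (Subtype.val '' S)

/-! If the conclusion fails, `U ∩ Gr Ā` misses the diagonal, because `A ⊆ Ā`. The complement of the
diagonal is open (`X` is Hausdorff), so c4 gives a `k` for which `U_k ∩ Gr A` misses it too. But `x
↦ U_k⁺(x) ∩ A(x)` has nonempty convex values and open lower sections, so the Fan–Browder theorem
gives it a fixed point, a contradiction.

Fan–Browder reduces to Brouwer on a simplex through a partition of unity. Brouwer follows from a
cubical Sperner lemma, proved as a discrete Stokes formula modulo two: `incrementProd` is the cup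
product of the coboundaries `df_j`, hence the coboundary of `f_0 · df_1 ⋯ df_n`, and its sum over a
grid reduces to one outer face, where induction applies. -/

/-! ### Cochains modulo two -/

/-- The product of the increments (modulo two) of the `j`-th function along the `j`-th step of the
sequence `v`. -/
def incrementProd {V : Type*} {n : ℕ} (f : Fin n → V → ZMod 2) (v : Fin (n + 1) → V) : ZMod 2 :=
  ∏ j, (f j (v j.succ) + f j (v j.castSucc))

theorem incrementProd_succ {V : Type*} {n : ℕ} (f : Fin (n + 1) → V → ZMod 2)
    (v : Fin (n + 2) → V) :
    incrementProd f v =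
      (f 0 (v 1) + f 0 (v 0)) * incrementProd (fun j => f j.succ) (fun j => v j.succ) := by
  simp [incrementProd, Fin.prod_univ_succ]

/-- The increment product is a cocycle. -/
theorem sum_incrementProd_succAbove {V : Type*} {n : ℕ} (f : Fin n → V → ZMod 2)
    (v : Fin (n + 2) → V) :
    ∑ k : Fin (n + 2), incrementProd f (fun j => v (k.succAbove j)) = 0 := by
  induction n with
  | zero =>
    simp only [incrementProd, Finset.univ_eq_empty, Finset.prod_empty]
    decide
  | succ n ih =>
    have h := ih (fun j => f j.succ) (fun j => v j.succ)
    rw [Fin.sum_univ_succ] at h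
    rw [Fin.sum_univ_succ, Fin.sum_univ_succ]
    simp only [incrementProd_succ f, Fin.succ_succAbove_succ, Fin.zero_succAbove,
      Fin.succ_succAbove_zero, ← Fin.succ_zero_eq_one] at h ⊢
    -- Faces 0 and 1 share their tail, and their first increments add up to the first increment of
    -- all other faces.
    rw [← Finset.mul_sum, eq_neg_of_add_eq_zero_right h]
    ring_nf
    have h2 : (2 : ZMod 2) = 0 := by decide
    simp [h2]

/-- The Leibniz rule for the increment product. -/
theorem sum_mul_incrementProd_succAbove {V : Type*} {n : ℕ} (f : Fin (n + 1) → V → ZMod 2)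
    (v : Fin (n + 2) → V) :
    ∑ k : Fin (n + 2), f 0 (v (k.succAbove 0)) *
      incrementProd (fun j => f j.succ) (fun j => v (k.succAbove j)) = incrementProd f v := by
  have h := sum_incrementProd_succAbove (fun j => f j.succ) v
  rw [Fin.sum_univ_succ] at h ⊢
  simp only [Fin.zero_succAbove, Fin.succ_succAbove_zero] at h ⊢
  rw [← Finset.mul_sum, eq_neg_of_add_eq_zero_right h, incrementProd_succ, CharTwo.neg_eq,
    Fin.succ_zero_eq_one]
  ring

/-! ### Freudenthal triangulation and cubical Sperner lemma -/

/-- The vertices of the simplex of the Freudenthal triangulation given by a base point and an order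
of the coordinates. -/
def stair {n : ℕ} (x : Fin n → ℕ) (σ : Equiv.Perm (Fin n)) (j : Fin (n + 1)) (a : Fin n) : ℕ :=
  x a + if (σ a).val < j.val then 1 else 0

/-- The facet shared by consecutive simplices in the direction of the first coordinate of the
order `σ`. -/
def stairFacet {n : ℕ} (x : Fin (n + 1) → ℕ) (σ : Equiv.Perm (Fin (n + 1))) (j : Fin (n + 1))
    (a : Fin (n + 1)) : ℕ :=
  x a + if σ a = 0 then 0 else if σ a ≤ j then 1 else 0

/-- Interior facets of a cube cancel in pairs. -/
theorem sum_stair_interior {n : ℕ} (Q : (Fin (n + 1) → Fin (n + 1) → ℕ) → ZMod 2)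
    (x : Fin (n + 1) → ℕ) (k : Fin n) :
    ∑ σ, Q (fun j => stair x σ (k.castSucc.succ.succAbove j)) = 0 := by
  have hne : k.castSucc ≠ k.succ := (Fin.castSucc_lt_succ).ne
  -- Swapping steps `k` and `k + 1` of the order moves only vertex `k + 1`, the omitted one.
  refine Finset.sum_involution (fun σ _ => Equiv.swap k.castSucc k.succ * σ) ?_ ?_ ?_ ?_
  · intro σ _
    have : (fun j => stair x (Equiv.swap k.castSucc k.succ * σ) (k.castSucc.succ.succAbove j)) =
        fun j => stair x σ (k.castSucc.succ.succAbove j) := by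
      funext j a
      simp only [stair, Equiv.Perm.mul_apply]
      have hj : (k.castSucc.succ.succAbove j).val ≠ k.val + 1 := by
        intro h
        exact Fin.succAbove_ne k.castSucc.succ j (Fin.ext (by simpa using h))
      congr 2
      generalize k.castSucc.succ.succAbove j = m at hj
      apply propext
      rw [Equiv.swap_apply_def]
      split_ifs with h1 h2
      · rw [h1]; simp; omega
      · rw [h2]; simp; omega
      · rfl
    rw [this, CharTwo.add_self_eq_zero]
  · intro σ _ _ h
    have : Equiv.swap k.castSucc k.succ = 1 := by simpa using h
    exact hne (Equiv.swap_eq_one_iff.1 this)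
  · intro σ _; exact Finset.mem_univ _
  · intro σ _; simp [← mul_assoc]

theorem stair_succ_eq_stairFacet {n : ℕ} (x : Fin (n + 1) → ℕ) (σ : Equiv.Perm (Fin (n + 1))) :
    (fun j : Fin (n + 1) => stair x σ j.succ) = stairFacet (x + Pi.single (σ.symm 0) 1) σ := by
  funext j a
  simp only [stair, stairFacet, Pi.add_apply, Fin.val_succ]
  by_cases h : σ a = 0
  · obtain rfl : a = σ.symm 0 := by rw [← h]; simp
    simp
  · have : a ≠ σ.symm 0 := by rintro rfl; simp at h
    rw [if_neg h, Pi.single_eq_of_ne this, add_zero]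
    simp only [Fin.le_def, Nat.lt_succ_iff]

/-- The inverse rotation makes the first direction of `σ` the last, so the facet without the last
vertex never moves in it. Together with `stair_succ_eq_stairFacet`, this makes the facet sums
telescope along that direction. -/
theorem stair_castSucc_eq_stairFacet {n : ℕ} (x : Fin (n + 1) → ℕ)
    (σ : Equiv.Perm (Fin (n + 1))) :
    (fun j : Fin (n + 1) => stair x ((finRotate (n + 1))⁻¹ * σ) j.castSucc) = stairFacet x σ := by
  funext j a
  obtain ⟨b, hb⟩ := (finRotate (n + 1)).surjective (σ a)
  have hab : ((finRotate (n + 1))⁻¹ * σ) a = b := by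
    rw [Equiv.Perm.mul_apply, ← hb]; exact Equiv.symm_apply_apply _ _
  simp only [stair, stairFacet, hab, ← hb, Fin.val_castSucc]
  rcases eq_or_ne b (Fin.last n) with rfl | hbl
  · rw [finRotate_last]
    have := j.is_le
    simp only [Fin.val_last]
    rw [if_neg (by omega)]
    simp
  · have h := coe_finRotate_of_ne_last hbl
    have h0 : finRotate (n + 1) b ≠ 0 := by
      intro h'; rw [h'] at h; simp at h
    rw [if_neg h0]
    simp only [Fin.le_def, h]
    rfl

/-- Telescoping sums over a grid. -/
theorem sum_grid_telescope {n N : ℕ} (G : (Fin (n + 1) → ℕ) → ZMod 2) (i : Fin (n + 1)) :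
    ∑ x : Fin (n + 1) → Fin N,
        (G ((fun a => (x a : ℕ)) + Pi.single i 1) + G (fun a => (x a : ℕ))) =
      ∑ y : Fin n → Fin N, (G (i.insertNth N (fun a => (y a : ℕ))) +
        G (i.insertNth 0 (fun a => (y a : ℕ)))) := by
  rw [← (Fin.insertNthEquiv (fun _ => Fin N) i).sum_comp, Fintype.sum_prod_type_right]
  refine Finset.sum_congr rfl fun y _ => ?_
  have h1 : ∀ t : Fin N, (fun a => ((i.insertNth t y : Fin (n + 1) → Fin N) a : ℕ)) =
      i.insertNth (t : ℕ) (fun a => (y a : ℕ)) := by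
    intro t
    rw [Fin.eq_insertNth_iff]
    constructor
    · simp
    · funext a; simp [Fin.removeNth]
  have h2 : ∀ t : ℕ, (i.insertNth t (fun a => (y a : ℕ)) + Pi.single i 1 : Fin (n + 1) → ℕ) =
      i.insertNth (t + 1) (fun a => (y a : ℕ)) := by
    intro t
    rw [Fin.eq_insertNth_iff]
    constructor
    · simp
    · funext a; simp [Fin.removeNth]
  simp only [Fin.insertNthEquiv_apply, h1, h2]
  rw [Fin.sum_univ_eq_sum_range
    (fun t => G (i.insertNth (t + 1) (fun a => (y a : ℕ))) + G (i.insertNth t fun a => (y a : ℕ)))]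
  have := Finset.sum_range_sub (fun t => G (i.insertNth t (fun a => (y a : ℕ)))) N
  simpa only [CharTwo.sub_eq_add] using this

/-- A cubical Sperner lemma, counted modulo two: if the `i`-th function is `0` where the `i`-th
coordinate is `0`, and `1` where it is `N`, then the number of simplices along which the `j`-th
function changes at the `j`-th step, for all `j`, is odd. -/
theorem sum_incrementProd_stair {n N : ℕ} (f : Fin n → (Fin n → ℕ) → ZMod 2)
    (h0 : ∀ i v, v i = 0 → f i v = 0) (h1 : ∀ i v, v i = N → f i v = 1) :
    ∑ x : Fin n → Fin N, ∑ σ, incrementProd f (stair (fun a => (x a : ℕ)) σ) = 1 := by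
  induction n with
  | zero => simp [incrementProd]
  | succ n ih =>
    set Q : (Fin (n + 1) → Fin (n + 1) → ℕ) → ZMod 2 := fun w =>
      f 0 (w 0) * incrementProd (fun j => f j.succ) w with hQ
    have step1 : ∀ x : Fin (n + 1) → ℕ, ∑ σ, incrementProd f (stair x σ) =
        ∑ σ, (Q (stairFacet (x + Pi.single (σ.symm 0) 1) σ) + Q (stairFacet x σ)) := by
      intro x
      have : ∀ σ, incrementProd f (stair x σ) =
          ∑ k : Fin (n + 2), Q (fun j => stair x σ (k.succAbove j)) := fun σ =>
        (sum_mul_incrementProd_succAbove f (stair x σ)).symm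
      simp only [this, Fin.sum_univ_succ (n := n + 1), Finset.sum_add_distrib,
        Fin.sum_univ_castSucc (n := n), Fin.zero_succAbove, stair_succ_eq_stairFacet]
      rw [Finset.sum_comm, Finset.sum_eq_zero fun k _ => sum_stair_interior Q x k, zero_add]
      congr 1
      rw [← Equiv.sum_comp (Equiv.mulLeft (finRotate (n + 1))⁻¹)]
      refine Finset.sum_congr rfl fun σ _ => ?_
      rw [← stair_castSucc_eq_stairFacet]
      simp [Fin.succ_last]
    simp only [step1]
    rw [Finset.sum_comm]
    have step2 := fun σ : Equiv.Perm (Fin (n + 1)) =>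
      sum_grid_telescope (N := N) (fun x => Q (stairFacet x σ)) (σ.symm 0)
    simp only [step2]
    have hval : ∀ (σ : Equiv.Perm (Fin (n + 1))) (c : ℕ) (y : Fin n → ℕ) (j : Fin (n + 1)),
        stairFacet ((σ.symm 0).insertNth c y) σ j (σ.symm 0) = c := by
      intro σ c y j
      simp [stairFacet]
    have side : ∀ (σ : Equiv.Perm (Fin (n + 1))) (c : ℕ) (y : Fin n → ℕ), σ.symm 0 ≠ 0 →
        (c = 0 ∨ c = N) → Q (stairFacet ((σ.symm 0).insertNth c y) σ) = 0 := by
      intro σ c y hσ hc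
      obtain ⟨i, hi⟩ := Fin.exists_succ_eq.2 hσ
      have hv := hval σ c y
      generalize stairFacet ((σ.symm 0).insertNth c y) σ = w at hv
      rw [hQ]
      -- On an outer face orthogonal to a direction other than 0, the function of that direction is
      -- constant, so its increment vanishes.
      refine mul_eq_zero_of_right _ (Finset.prod_eq_zero (Finset.mem_univ i) ?_)
      rw [← hi] at hv
      change f i.succ (w i.succ) + f i.succ (w i.castSucc) = 0
      rcases hc with rfl | rfl
      · rw [h0 _ _ (hv _), h0 _ _ (hv _), add_zero]
      · rw [h1 _ _ (hv _), h1 _ _ (hv _), CharTwo.add_self_eq_zero]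
    -- Only orders fixing 0 contribute; of their two faces, the one with `f 0 = 1` is the grid of
    -- one dimension less.
    rw [← Equiv.Perm.decomposeFin.symm.sum_comp, Fintype.sum_prod_type, Fintype.sum_eq_single 0]
    · rw [Finset.sum_comm]
      rw [← ih (fun j v => f j.succ (Fin.cons N v))
        (fun i v hv => h0 _ _ (by simpa using hv)) (fun i v hv => h1 _ _ (by simpa using hv))]
      refine Finset.sum_congr rfl fun y _ => Finset.sum_congr rfl fun e _ => ?_
      have hz : (Equiv.Perm.decomposeFin.symm (0, e)).symm 0 = 0 := by
        rw [Equiv.symm_apply_eq, Equiv.Perm.decomposeFin_symm_apply_zero]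
      have hv := hval (Equiv.Perm.decomposeFin.symm (0, e))
      rw [hz] at hv ⊢
      have hb : Q (stairFacet ((0 : Fin (n + 1)).insertNth 0 fun a => (y a : ℕ))
          (Equiv.Perm.decomposeFin.symm (0, e))) = 0 := by
        rw [hQ]; exact mul_eq_zero_of_left (h0 _ _ (hv _ _ _)) _
      rw [hb, add_zero, hQ]
      dsimp only
      rw [h1 _ _ (hv _ _ _), one_mul]
      have : stairFacet ((0 : Fin (n + 1)).insertNth N fun a => (y a : ℕ))
          (Equiv.Perm.decomposeFin.symm (0, e)) =
          fun j => Fin.cons N (stair (fun a => (y a : ℕ)) e j) := by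
        funext j a
        refine Fin.cases ?_ (fun b => ?_) a
        · simp [stairFacet]
        · simp [stairFacet, stair, Fin.le_def]
      rw [this]
      rfl
    · intro p hp
      refine Finset.sum_eq_zero fun e _ => Finset.sum_eq_zero fun y _ => ?_
      have hz : (Equiv.Perm.decomposeFin.symm (p, e)).symm 0 ≠ 0 := by
        rw [Ne, Equiv.symm_apply_eq, Equiv.Perm.decomposeFin_symm_apply_zero]
        exact fun h => hp h.symm
      rw [side _ _ _ hz (Or.inr rfl), side _ _ _ hz (Or.inl rfl), add_zero]

/-- In a suitable cube of the grid all functions take both values. -/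
theorem exists_cube_both_values {n N : ℕ} (f : Fin n → (Fin n → ℕ) → ZMod 2)
    (h0 : ∀ i v, v i = 0 → f i v = 0) (h1 : ∀ i v, v i = N → f i v = 1) :
    ∃ x : Fin n → ℕ, (∀ a, x a < N) ∧ ∀ i, ∃ u w : Fin n → ℕ,
      (∀ a, x a ≤ u a ∧ u a ≤ x a + 1) ∧ (∀ a, x a ≤ w a ∧ w a ≤ x a + 1) ∧
        f i u = 0 ∧ f i w = 1 := by
  have h := sum_incrementProd_stair f h0 h1
  obtain ⟨x, -, hx⟩ := Finset.exists_ne_zero_of_sum_ne_zero (h.trans_ne one_ne_zero)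
  obtain ⟨σ, -, hσ⟩ := Finset.exists_ne_zero_of_sum_ne_zero hx
  refine ⟨fun a => x a, fun a => (x a).2, fun i => ?_⟩
  have hi := Finset.prod_ne_zero_iff.1 hσ i (Finset.mem_univ i)
  have hb : ∀ j a, (x a : ℕ) ≤ stair (fun a => (x a : ℕ)) σ j a ∧
      stair (fun a => (x a : ℕ)) σ j a ≤ x a + 1 := by
    intro j a
    simp only [stair]
    split_ifs <;> omega
  have key : ∀ p q : ZMod 2, p + q ≠ 0 → (p = 0 ∧ q = 1) ∨ (q = 0 ∧ p = 1) := by decide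
  rcases key _ _ hi with ⟨hp, hq⟩ | ⟨hp, hq⟩
  · exact ⟨_, _, hb _, hb _, hp, hq⟩
  · exact ⟨_, _, hb _, hb _, hp, hq⟩

/-! ### Brouwer's theorem for cube and simplex -/

/-- A continuous self-map of the cube almost fixes some point. -/
theorem exists_almost_fixed_cube {n : ℕ} (g : (Fin n → ℝ) → Fin n → ℝ)
    (hg : ContinuousOn g (Set.Icc 0 1)) (hm : Set.MapsTo g (Set.Icc 0 1) (Set.Icc 0 1))
    {ε : ℝ} (hε : 0 < ε) : ∃ p ∈ Set.Icc (0 : Fin n → ℝ) 1, dist (g p) p ≤ 2 * ε := by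
  classical
  obtain ⟨δ, hδ, hu⟩ := Metric.uniformContinuousOn_iff.1
    (isCompact_Icc.uniformContinuousOn_of_continuous hg) ε hε
  obtain ⟨k, hk⟩ := exists_nat_one_div_lt (lt_min hδ hε)
  obtain ⟨N, hN⟩ : ∃ N : ℕ, N = k + 1 := ⟨_, rfl⟩
  have hN0 : (0 : ℝ) < N := by rw [hN]; positivity
  have hNδ : 1 / (N : ℝ) < δ := by rw [hN]; push_cast; exact hk.trans_le (min_le_left _ _)
  have hNε : 1 / (N : ℝ) < ε := by rw [hN]; push_cast; exact hk.trans_le (min_le_right _ _)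
  set P : (Fin n → ℕ) → Fin n → ℝ := fun v a => (v a : ℝ) / N with hP
  have hPmem : ∀ v : Fin n → ℕ, (∀ a, v a ≤ N) → P v ∈ Set.Icc (0 : Fin n → ℝ) 1 := by
    intro v hv
    refine ⟨fun a => ?_, fun a => ?_⟩
    · simp only [hP, Pi.zero_apply]; positivity
    · simp only [hP, Pi.one_apply]
      rw [div_le_one hN0]
      exact_mod_cast hv a
  obtain ⟨x, hx, hf⟩ := exists_cube_both_values (N := N)
    -- The label records the sign of `g p i - p i`; the values forced on the faces agree with it up
    -- to ties, as `g` preserves the cube.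
    (fun i v => if v i = 0 then 0 else if v i = N then 1 else if P v i ≤ g (P v) i then 0 else 1)
    (fun i v hv => by simp [hv]) (fun i v hv => by
      have : N ≠ 0 := by omega
      simp [hv, this])
  have hp := hPmem x fun a => (hx a).le
  refine ⟨P x, hp, ?_⟩
  have near : ∀ u : Fin n → ℕ, (∀ a, x a ≤ u a ∧ u a ≤ x a + 1) →
      P u ∈ Set.Icc (0 : Fin n → ℝ) 1 ∧ (∀ i, P x i ≤ P u i ∧ P u i ≤ P x i + 1 / N) ∧
        ∀ i, |g (P u) i - g (P x) i| < ε := by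
    intro u hxu
    have hmem := hPmem u fun a => (hxu a).2.trans (hx a)
    have hb : ∀ i, P x i ≤ P u i ∧ P u i ≤ P x i + 1 / N := by
      intro i
      simp only [hP, ← add_div]
      constructor
      · gcongr; exact (hxu i).1
      · gcongr; exact_mod_cast (hxu i).2
    refine ⟨hmem, hb, fun i => ?_⟩
    have hd : dist (P u) (P x) < δ := by
      refine lt_of_le_of_lt ((dist_pi_le_iff (by positivity)).2 fun i => ?_) hNδ
      rw [Real.dist_eq, abs_le]
      constructor <;> linarith [(hb i).1, (hb i).2, one_div_pos.2 hN0]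
    have := (dist_le_pi_dist (g (P u)) (g (P x)) i).trans_lt (hu _ hmem _ hp hd)
    rwa [Real.dist_eq] at this
  refine (dist_pi_le_iff (by positivity)).2 fun i => ?_
  obtain ⟨u, w, hxu, hxw, hfu, hfw⟩ := hf i
  obtain ⟨hu1, hu2, hu3⟩ := near u hxu
  obtain ⟨hw1, hw2, hw3⟩ := near w hxw
  have hlow : P u i ≤ g (P u) i := by
    by_cases h1 : u i = 0
    · have := (hm hu1).1 i
      simpa [hP, h1] using this
    by_cases h2 : u i = N
    · exfalso
      simp only [h2, if_true] at hfu
      split_ifs at hfu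
      · omega
      · exact one_ne_zero hfu
    by_contra h3
    simp [h1, h2, h3] at hfu
  have hup : g (P w) i ≤ P w i := by
    by_cases h1 : w i = 0
    · simp [h1] at hfw
    by_cases h2 : w i = N
    · have := (hm hw1).2 i
      have h3 : P w i = 1 := by simp only [hP, h2]; exact div_self hN0.ne'
      rw [h3]; exact this
    by_contra h3
    simp [h1, h2, (not_le.1 h3).le] at hfw
  rw [Real.dist_eq, abs_le]
  have a1 := abs_lt.1 (hu3 i)
  have a2 := abs_lt.1 (hw3 i)
  constructor <;> linarith [(hu2 i).1, (hw2 i).2, a1.1, a1.2, a2.1, a2.2]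

/-- **Brouwer's fixed point theorem** for the cube. -/
theorem exists_fixed_point_cube {n : ℕ} (g : (Fin n → ℝ) → Fin n → ℝ)
    (hg : ContinuousOn g (Set.Icc 0 1)) (hm : Set.MapsTo g (Set.Icc 0 1) (Set.Icc 0 1)) :
    ∃ p ∈ Set.Icc (0 : Fin n → ℝ) 1, g p = p := by
  obtain ⟨p, hp, hmin⟩ := isCompact_Icc.exists_isMinOn
    (Set.nonempty_Icc.2 (zero_le_one' (Fin n → ℝ))) (continuous_dist.comp_continuousOn (hg.prodMk continuousOn_id))
  refine ⟨p, hp, dist_le_zero.1 (le_of_forall_pos_le_add fun ε hε => ?_)⟩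
  obtain ⟨q, hq, hqd⟩ := exists_almost_fixed_cube g hg hm (half_pos hε)
  have : dist (g p) p ≤ dist (g q) q := isMinOn_iff.1 hmin q hq
  linarith

/-- The simplex is a retract of the ambient coordinate space. -/
theorem exists_retraction_stdSimplex (m : ℕ) [NeZero m] :
    ∃ r : (Fin m → ℝ) → stdSimplex ℝ (Fin m), Continuous r ∧ ∀ s : stdSimplex ℝ (Fin m),
      r s.1 = s := by
  set S : (Fin m → ℝ) → ℝ := fun x => ∑ i, max (x i) 0 with hS
  have hSc : Continuous S := by fun_prop
  have hpos : ∀ x, 0 < max 1 (S x) := fun x => lt_max_of_lt_left one_pos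
  have hm : (m : ℝ) ≠ 0 := by exact_mod_cast NeZero.ne m
  -- Normalised positive part: a total below 1 is topped up equally, one above 1 is divided out, so
  -- the denominator never vanishes.
  refine ⟨fun x => ⟨fun i => (max (x i) 0 + max 0 (1 - S x) / m) / max 1 (S x), fun i => ?_, ?_⟩,
    ?_, fun s => ?_⟩
  · have := hpos x
    positivity
  · rw [← Finset.sum_div, Finset.sum_add_distrib, div_eq_one_iff_eq (hpos x).ne']
    simp only [Finset.sum_const, Finset.card_univ, Fintype.card_fin, nsmul_eq_mul]
    rw [mul_div_cancel₀ _ hm]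
    change S x + _ = _
    rcases le_total (S x) 1 with h | h
    · rw [max_eq_left h, max_eq_right (by linarith)]; ring
    · rw [max_eq_right h, max_eq_left (by linarith)]; ring
  · refine Continuous.subtype_mk (continuous_pi fun i => ?_) _
    exact Continuous.div (by fun_prop) (by fun_prop) fun x => (hpos x).ne'
  · have h1 : ∀ i, max (s.1 i) 0 = s.1 i := fun i => max_eq_left (s.2.1 i)
    have h2 : S s.1 = 1 := by simp only [hS, h1]; exact s.2.2
    apply Subtype.ext
    funext i
    simp [h1, h2]

/-- **Brouwer's fixed point theorem** for the simplex. -/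
theorem exists_fixed_point_stdSimplex {m : ℕ} [NeZero m]
    (h : stdSimplex ℝ (Fin m) → stdSimplex ℝ (Fin m)) (hc : Continuous h) :
    ∃ s, h s = s := by
  obtain ⟨r, hr, hrs⟩ := exists_retraction_stdSimplex m
  obtain ⟨p, -, hp⟩ := exists_fixed_point_cube (fun x => (h (r x)).1)
    (continuous_subtype_val.comp (hc.comp hr)).continuousOn (fun x _ => ⟨fun i => (h (r x)).2.1 i, fun i => by
      have := Finset.single_le_sum (fun j _ => (h (r x)).2.1 j) (Finset.mem_univ i)
      rw [(h (r x)).2.2] at this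
      exact this⟩)
  refine ⟨h (r p), ?_⟩
  have : r p = h (r p) := by
    conv_lhs => rw [← hp]
    exact hrs _
  rw [← this]
  exact this.symm

/-! ### Fan–Browder theorem and conclusion -/

/-- The **Fan–Browder fixed point theorem**. -/
theorem exists_mem_of_hasOpenLowerSections {E : Type*} [AddCommGroup E] [Module ℝ E]
    [TopologicalSpace E] [IsTopologicalAddGroup E] [ContinuousSMul ℝ E] [T2Space E]
    {X : Set E} (hXne : X.Nonempty) (hXconv : Convex ℝ X) (hXcomp : IsCompact X)
    (T : X → Set X) (hne : ∀ x, (T x).Nonempty) (hconv : ∀ x, ConvexIn (T x))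
    (hopen : HasOpenLowerSections T) : ∃ x, x ∈ T x := by
  have : CompactSpace X := isCompact_iff_compactSpace.1 hXcomp
  rw [hasOpenLowerSections_iff_isOpen] at hopen
  obtain ⟨t, ht⟩ := isCompact_univ.elim_finite_subcover (fun y => {x | y ∈ T x}) hopen
    (fun x _ => Set.mem_iUnion.2 (hne x))
  obtain ⟨m, y, hy⟩ : ∃ (m : ℕ) (y : Fin m → X), ∀ x, ∃ i, y i ∈ T x := by
    refine ⟨t.card, fun i => (t.equivFin.symm i).1, fun x => ?_⟩
    obtain ⟨z, hz, hzx⟩ := Set.mem_iUnion₂.1 (ht (Set.mem_univ x))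
    exact ⟨t.equivFin ⟨z, hz⟩, by simpa using hzx⟩
  have : NeZero m := by
    obtain ⟨i, -⟩ := hy ⟨_, hXne.some_mem⟩
    exact ⟨by rintro rfl; exact i.elim0⟩
  obtain ⟨ρ, hρ⟩ := PartitionOfUnity.exists_isSubordinate isClosed_univ
    (fun i => {x | y i ∈ T x}) (fun i => hopen (y i)) (fun x _ => Set.mem_iUnion.2 (hy x))
  have hsum : ∀ x, ∑ i, ρ i x = 1 := fun x => by
    rw [← finsum_eq_sum_of_fintype]; exact ρ.sum_eq_one (Set.mem_univ x)
  set z : stdSimplex ℝ (Fin m) → X := fun s =>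
    ⟨∑ i, s.1 i • (y i : E),
      hXconv.sum_mem (fun i _ => s.2.1 i) s.2.2 fun i _ => (y i).2⟩ with hz
  have hzc : Continuous z := by
    refine Continuous.subtype_mk ?_ _
    exact continuous_finsetSum _ fun i _ =>
      ((continuous_apply i).comp continuous_subtype_val).smul continuous_const
  -- Brouwer is applied to weights rather than points of `X`: at the fixed `s`, every `y i` of
  -- nonzero weight in `z s` lies in `T (z s)`.
  obtain ⟨s, hs⟩ := exists_fixed_point_stdSimplex
    (fun s => ⟨fun i => ρ i (z s), fun i => ρ.nonneg i _, hsum _⟩)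
    (Continuous.subtype_mk (continuous_pi fun i => (ρ i).continuous.comp hzc) _)
  have hval : ∀ i, s.1 i = ρ i (z s) := fun i =>
    (congrFun (congrArg Subtype.val hs) i).symm
  refine ⟨z s, ?_⟩
  have hmem : ((z s : X) : E) ∈ Subtype.val '' T (z s) := by
    have hzs : ((z s : X) : E) =
        ∑ i ∈ Finset.univ.filter (fun i => s.1 i ≠ 0),
          s.1 i • (y i : E) := by
      rw [Finset.sum_filter_of_ne]
      exact fun i _ h h0 => h (by rw [h0, zero_smul])
    rw [hzs]
    refine (hconv (z s)).sum_mem (fun i _ => s.2.1 i) ?_ fun i hi => ?_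
    · rw [Finset.sum_filter_ne_zero]; exact s.2.2
    · refine ⟨y i, hρ i (subset_tsupport _ ?_), rfl⟩
      rw [Function.mem_support, ← hval]
      exact (Finset.mem_filter.1 hi).2
  obtain ⟨w, hw, hwz⟩ := hmem
  rwa [Subtype.ext hwz] at hw

theorem theorem5 {E : Type*} [AddCommGroup E] [Module ℝ E] [TopologicalSpace E]
    [IsTopologicalAddGroup E] [ContinuousSMul ℝ E] [LocallyConvexSpace ℝ E] [T2Space E]
    (X : Set E) (hXne : X.Nonempty) (hXconv : Convex ℝ X) (hXcomp : IsCompact X)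
    (A : X → Set X) (P : X × X → Set X)
    (a_nonempty : ∀ x : X, (A x).Nonempty)
    (a_convex : ∀ x : X, ConvexIn (A x))
    (a_open : HasOpenLowerSections A)
    (b_closed : IsClosed (disjointPairs (corrAdherence A) P))
    (b_nonempty : (disjointPairs (corrAdherence A) P ∩ corrGraph (corrAdherence A)).Nonempty)
    (hc : ∃ Pk : ℕ+ → X × X → Set X,
      -- c1)
      (∀ k : ℕ+, ∀ x : X,
        ConvexIn {y : X | (x, y) ∈ disjointPairs (corrAdherence A) (Pk k)} ∧
        ({y : X | (x, y) ∈ disjointPairs (corrAdherence A) (Pk k)} ∩ A x).Nonempty) ∧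
      -- c2)
      (∀ k : ℕ+, ∀ y : X,
        IsOpen {x : X | (x, y) ∈ disjointPairs (corrAdherence A) (Pk k)}) ∧
      -- c3)
      (∀ k : ℕ+, ∀ p : X × X, Pk k p ⊆ Pk (k + 1) p) ∧
      -- c4)
      (∀ G : Set (X × X), IsOpen G →
        disjointPairs (corrAdherence A) P ∩ corrGraph (corrAdherence A) ⊆ G →
        ∃ k : ℕ+, disjointPairs (corrAdherence A) (Pk k) ∩ corrGraph A ⊆ G)) :
    ∃ x : X, x ∈ corrAdherence A x ∧ A x ∩ P (x, x) = ∅ := by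

  obtain ⟨Pk, hc1, hc2, -, hc4⟩ := hc
  by_contra! hcon
  obtain ⟨k, hk⟩ := hc4 {p | p.1 ≠ p.2} (isOpen_ne_fun continuous_fst continuous_snd) (by
    rintro ⟨x, y⟩ ⟨hU, hA⟩ (rfl : x = y)
    obtain ⟨z, hzA, hzP⟩ := hcon x hA
    have hz : z ∈ corrAdherence A x ∩ P (x, x) := ⟨subset_closure hzA, hzP⟩
    rw [show corrAdherence A x ∩ P (x, x) = ∅ from hU] at hz
    exact hz)
  obtain ⟨x, hxU, hxA⟩ := exists_mem_of_hasOpenLowerSections hXne hXconv hXcomp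
    (fun x => {y : X | (x, y) ∈ disjointPairs (corrAdherence A) (Pk k)} ∩ A x)
    (fun x => (hc1 k x).2)
    (fun x => by
      have h := (hc1 k x).1.inter (a_convex x)
      rwa [← Set.image_inter Subtype.val_injective] at h)
    (hasOpenLowerSections_iff_isOpen.2 fun y =>
      (hc2 k y).inter (hasOpenLowerSections_iff_isOpen.1 a_open y))
  exact hk ⟨hxU, hxA⟩ rfl
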